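/- For a polytope $P\subset\mathbb{R}^n$ (the convex hull of a finite set of points), let $\mathrm{xc}_{LP}(P)$ be the smallest $k$ such that $P=\pi(\mathbb{R}^k_+\cap L)$ for some linear map $\pi:\mathbb{R}^k\to\mathbb{R}^n$ and some affine subspace $L\subset\mathbb{R}^k$, and let $\mathrm{xc}_{PSD}(P)$ be the smallest $k$ such that $P=\pi(\mathbf{H}^k_+\cap L)$ for some real-linear map $\pi:\mathbf{H}^k\to\mathbb{R}^n$ and some affine subspace $L\subset\mathbf{H}^k$, where $\mathbf{H}^k$ is the real vector space of $k\times k$ complex Hermitian matrices and $\mathbf{H}^k_+\subset\mathbf{H}^k$ is the cone of positive semidefinite ones. For positive integers $N,d$ let \[ TC(N,2d)=\mathrm{conv}\{M(2\pi x/N): x=0,1,\dots,N-1\}\subset\mathbb{R}^{2d},\qquad M(\theta)=(\cos\theta,\sin\theta,\cos 2\theta,\sin 2\theta,\dots,\cos d\theta,\sin d\theta). \] Then there is a family of polytopes $P_d\subset\mathbb{R}^{2d}$, namely $P_d=TC(d^2,2d)$, such that, as $d\to\infty$, \[ \mathrm{xc}_{PSD}(P_d)=O(d\log d),\qquad \mathrm{xc}_{LP}(P_d)=\Omega(d^2),\qquad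 \frac{\mathrm{xc}_{PSD}(P_d)}{\mathrm{xc}_{LP}(P_d)}=O\left(\frac{\log d}{d}\right). \] -/

import Mathlib

open Asymptotics Filter

/-- A polytope in `ℝⁿ`: the convex hull of a finite set of points. -/
def IsPolytope {n : ℕ} (P : Set (EuclideanSpace ℝ (Fin n))) : Prop :=
  ∃ s : Set (EuclideanSpace ℝ (Fin n)), s.Finite ∧ P = convexHull ℝ s

/-- `P` has an LP lift of size `k`: it is the image under a linear map of the intersection of the
nonnegative orthant `ℝᵏ₊` with an affine subspace of `ℝᵏ`. -/
def HasLPLift {n : ℕ} (P : Set (EuclideanSpace ℝ (Fin n))) (k : ℕ) : Prop :=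
  ∃ (π : (Fin k → ℝ) →ₗ[ℝ] EuclideanSpace ℝ (Fin n)) (L : AffineSubspace ℝ (Fin k → ℝ)),
    P = π '' {x | (∀ i, 0 ≤ x i) ∧ x ∈ L}

/-- The real vector space of `k × k` complex Hermitian matrices. -/
abbrev HermitianMatrix (k : ℕ) : Type := selfAdjoint (Matrix (Fin k) (Fin k) ℂ)

open scoped ComplexOrder in
/-- `P` has a (Hermitian) PSD lift of size `k`: it is the image under a real-linear map of the
intersection of the cone of `k × k` Hermitian positive semidefinite matrices with an affine
subspace of the real vector space of `k × k` Hermitian matrices. -/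
def HasPSDLift {n : ℕ} (P : Set (EuclideanSpace ℝ (Fin n))) (k : ℕ) : Prop :=
  ∃ (π : HermitianMatrix k →ₗ[ℝ] EuclideanSpace ℝ (Fin n))
    (L : AffineSubspace ℝ (HermitianMatrix k)),
    P = π '' {X | (X : Matrix (Fin k) (Fin k) ℂ).PosSemidef ∧ X ∈ L}

/-- LP extension complexity: the smallest size of an LP lift. (For a polytope an LP lift exists,
see `IsPolytope.exists_hasLPLift`, so that the infimum is attained.) -/
noncomputable def xcLP {n : ℕ} (P : Set (EuclideanSpace ℝ (Fin n))) : ℕ :=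
  sInf {k | HasLPLift P k}

/-- PSD extension complexity: the smallest size of a Hermitian PSD lift. (For a polytope a PSD lift
exists, see `IsPolytope.exists_hasPSDLift`, so that the infimum is attained.) -/
noncomputable def xcPSD {n : ℕ} (P : Set (EuclideanSpace ℝ (Fin n))) : ℕ :=
  sInf {k | HasPSDLift P k}

/-- The trigonometric moment curve of degree `d`,
`M(θ) = (cos θ, sin θ, cos 2θ, sin 2θ, …, cos dθ, sin dθ)`. Coordinates are numbered from `0`:
coordinate `2m` is `cos ((m + 1) θ)` and coordinate `2m + 1` is `sin ((m + 1) θ)`. -/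
noncomputable def trigMomentCurve (d : ℕ) (θ : ℝ) : EuclideanSpace ℝ (Fin (2 * d)) :=
  WithLp.toLp 2 fun j : Fin (2 * d) =>
    if (j : ℕ) % 2 = 0 then Real.cos ((((j : ℕ) / 2 + 1 : ℕ) : ℝ) * θ)
    else Real.sin ((((j : ℕ) / 2 + 1 : ℕ) : ℝ) * θ)

/-- The regular trigonometric cyclic polytope `TC(N, 2d) ⊆ ℝ²ᵈ` of degree `d`: the convex hull of
the points `M(2πx/N)`, `x = 0, 1, …, N - 1`. -/
noncomputable def trigCyclicPolytope (N d : ℕ) : Set (EuclideanSpace ℝ (Fin (2 * d))) :=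
  convexHull ℝ (Set.range fun x : Fin N =>
    trigMomentCurve d (2 * Real.pi * ((x : ℕ) : ℝ) / (N : ℝ)))

theorem trigCyclicPolytope_isPolytope (N d : ℕ) : IsPolytope (trigCyclicPolytope N d) :=
  ⟨_, Set.finite_range _, rfl⟩

theorem convexHull_range_eq_image {n N : ℕ} (f : Fin N → EuclideanSpace ℝ (Fin n)) :
    convexHull ℝ (Set.range f) =
      (Fintype.linearCombination ℝ f) '' stdSimplex ℝ (Fin N) := by
  rw [← _root_.convexHull_basis_eq_stdSimplex ℝ (Fin N), LinearMap.image_convexHull,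
    ← Set.range_comp]
  refine congrArg (fun t => convexHull ℝ (Set.range t)) ?_
  funext i
  simp [Function.comp, Fintype.linearCombination_apply]

theorem IsPolytope.exists_range {n : ℕ} {P : Set (EuclideanSpace ℝ (Fin n))}
    (hP : IsPolytope P) :
    ∃ (N : ℕ) (f : Fin N → EuclideanSpace ℝ (Fin n)), P = convexHull ℝ (Set.range f) := by
  obtain ⟨s, hs, rfl⟩ := hP
  obtain ⟨N, f, -, hf⟩ := hs.fin_param
  exact ⟨N, f, by rw [hf]⟩

/-- Every polytope has an LP lift (of size the number of points spanning it). -/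
theorem IsPolytope.exists_hasLPLift {n : ℕ} {P : Set (EuclideanSpace ℝ (Fin n))}
    (hP : IsPolytope P) : ∃ k, HasLPLift P k := by
  obtain ⟨N, f, rfl⟩ := hP.exists_range
  refine ⟨N, Fintype.linearCombination ℝ f,
    (AffineSubspace.mk' (1 : ℝ) ⊥).comap
      (∑ i : Fin N, LinearMap.proj (R := ℝ) (φ := fun _ : Fin N => ℝ) i).toAffineMap, ?_⟩
  rw [convexHull_range_eq_image]
  congr 1
  ext x
  simp [stdSimplex, AffineSubspace.mem_mk', sub_eq_zero]

open scoped ComplexOrder in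
/-- Every polytope has a Hermitian PSD lift (of size the number of points spanning it). -/
theorem IsPolytope.exists_hasPSDLift {n : ℕ} {P : Set (EuclideanSpace ℝ (Fin n))}
    (hP : IsPolytope P) : ∃ k, HasPSDLift P k := by
  obtain ⟨N, f, rfl⟩ := hP.exists_range
  let D : HermitianMatrix N →ₗ[ℝ] (Fin N → ℝ) :=
    { toFun := fun X i => ((X : Matrix (Fin N) (Fin N) ℂ) i i).re
      map_add' := fun X Y => by ext i; simp
      map_smul' := fun c X => by ext i; simp }
  refine ⟨N, (Fintype.linearCombination ℝ f).comp D,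
    (AffineSubspace.mk' (1 : ℝ) ⊥).comap
      ((∑ i : Fin N, LinearMap.proj (R := ℝ) (φ := fun _ : Fin N => ℝ) i).comp D).toAffineMap, ?_⟩
  rw [convexHull_range_eq_image, LinearMap.coe_comp, Set.image_comp]
  congr 1
  ext x
  constructor
  · rintro ⟨h0, h1⟩
    refine ⟨⟨Matrix.diagonal fun i => (x i : ℂ), ?_⟩, ⟨?_, ?_⟩, ?_⟩
    · exact Matrix.isHermitian_diagonal_of_self_adjoint _
        (funext fun i => by simp)
    · exact Matrix.PosSemidef.diagonal fun i => by simpa using h0 i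
    · simpa [D, AffineSubspace.mem_mk', sub_eq_zero] using h1
    · ext i; simp [D]
  · rintro ⟨X, ⟨hX, hL⟩, rfl⟩
    refine ⟨fun i => ?_, ?_⟩
    · exact (Complex.le_def.1 (hX.diag_nonneg (i := i))).1
    · simpa [AffineSubspace.mem_mk', sub_eq_zero] using hL

theorem IsPolytope.hasLPLift_xcLP {n : ℕ} {P : Set (EuclideanSpace ℝ (Fin n))}
    (hP : IsPolytope P) : HasLPLift P (xcLP P) :=
  Nat.sInf_mem (s := {k | HasLPLift P k}) hP.exists_hasLPLift

theorem IsPolytope.hasPSDLift_xcPSD {n : ℕ} {P : Set (EuclideanSpace ℝ (Fin n))}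
    (hP : IsPolytope P) : HasPSDLift P (xcPSD P) :=
  Nat.sInf_mem (s := {k | HasPSDLift P k}) hP.exists_hasPSDLift

/-!
The extension complexities of `TC(d², 2d)` are estimated separately.

*Lower bound for LP lifts.* The polytope is `d`-neighborly: any `d` vertices are exactly the zeros,
among all vertices, of the nonnegative trigonometric polynomial `∏ (1 - cos (θ - θₐ))`, which is an
affine function on the moment curve (`trigCyclic_neighborly`). Lift each vertex to a point of the
nonnegative orthant `ℝᵏ₊` and record its support. Neighborliness forces the support of one lifted
vertex never to lie in the union of the supports of `d` others (`exists_mem_support_of_face`), and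
such a family of `N` subsets of `{1, …, k}` exists only if `k ≥ min (N, (d + 1)(d + 2) / 2)`
(`coverFree_card_bound`). For `N = d²` this is of order `d²`.

*Upper bound for PSD lifts.* With `N = d²`, let `T ⊆ ℕ` be finite and lift the vertex with
number `x` to the rank one matrix `χ(x(t - s))`, `s, t ∈ T`, where `χ` is the standard character of
`ℤ/N`. The lift consists of all PSD matrices of the form `y(t - s)` with `y(0) = 1`. The point is
that `T` can be chosen with `O(d log d)` elements so that the values `y(1), …, y(d)` of every such
matrix are moments of a probability measure on `ℤ/N`. If the entries `y(t - s)` with `s, t` at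
cyclic distance at most `d` can be completed to an `N × N` PSD matrix, then the quadratic form of
that matrix at the characters gives such a measure (`sum_norm_sq_mul_stdAddChar`). The completion
comes from a triangulation of a polygon: cut `ℤ/N` into `d` consecutive blocks of length `d` and
view these as the vertices of a `d`-gon. PSD matrices, thought of as Gram matrices, can be glued
along a common principal submatrix (`exists_gram_eq_and_eqOn`), so it is enough that `y(t - s)` is
PSD on each triangle of a triangulation of the `d`-gon; as the matrix is Toeplitz, only the shape of
a triangle matters. Splitting a path of `a + b` blocks into paths of `a` and of `b` blocks uses the
triangle `0, a, a + b`, so all triangles needed are found among the blocks numbered by an addition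
chain for `d - 1` (`exists_gram_path`), and there is one of length `O(log d)`
(`exists_isAdditionChain`).
-/

/-! ### Cover-free families -/

/-- If no member of a finite family of subsets of `B` is contained in the union of `d` others, then
the family has at most `|B|` members or `|B| ≥ (d + 1)(d + 2) / 2`. Either every member has an
element of its own, or some member has none; that member then has more than `d` elements, and
removing it together with its elements leaves a family with the same property for `d - 1`. -/
theorem coverFree_card_bound {ι κ : Type*} [DecidableEq ι] [DecidableEq κ] (d : ℕ) :
    ∀ (A : Finset ι) (B : Finset κ) (S : ι → Finset κ), (∀ i ∈ A, S i ⊆ B) →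
      (∀ i ∈ A, ∀ D ⊆ A, D.card ≤ d → i ∉ D → ¬ S i ⊆ D.biUnion S) →
      A.card ≤ B.card ∨ (d + 1) * (d + 2) ≤ 2 * B.card := by
  -- A member without an element of its own is covered by at most `|S i|` others.
  have key : ∀ (d : ℕ) (A : Finset ι) (B : Finset κ) (S : ι → Finset κ), (∀ i ∈ A, S i ⊆ B) →
      (∀ i ∈ A, ∀ D ⊆ A, D.card ≤ d → i ∉ D → ¬ S i ⊆ D.biUnion S) →
      A.card ≤ B.card ∨ ∃ i ∈ A, d + 1 ≤ (S i).card := by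
    intro d A B S hB hS
    by_cases h : ∀ i ∈ A, ∃ e ∈ S i, ∀ j ∈ A, e ∈ S j → j = i
    · left
      rcases A.eq_empty_or_nonempty with rfl | ⟨i₀, hi₀⟩
      · simp
      have : Nonempty κ := ⟨(h i₀ hi₀).choose⟩
      choose! f hf hf' using h
      refine Finset.card_le_card_of_injOn f (fun i hi => hB i hi (hf i hi)) ?_
      intro i hi j hj hij
      exact hf' j hj i hi (hij ▸ hf i hi)
    · right
      push Not at h
      obtain ⟨i, hi, h⟩ := h
      have : Nonempty ι := ⟨i⟩
      choose! g hgA hgS hgne using h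
      refine ⟨i, hi, ?_⟩
      by_contra hlt
      refine hS i hi ((S i).image g) ?_ ?_ ?_ ?_
      · intro j hj
        obtain ⟨e, he, rfl⟩ := Finset.mem_image.1 hj
        exact hgA e he
      · exact Finset.card_image_le.trans (by omega)
      · intro hi'
        obtain ⟨e, he, he'⟩ := Finset.mem_image.1 hi'
        exact hgne e he he'
      · intro e he
        exact Finset.mem_biUnion.2 ⟨g e, Finset.mem_image_of_mem g he, hgS e he⟩
  induction d with
  | zero =>
    intro A B S hB hS
    refine (key 0 A B S hB hS).imp id ?_
    rintro ⟨i, hi, hc⟩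
    have := Finset.card_le_card (hB i hi)
    omega
  | succ d ih =>
    intro A B S hB hS
    rcases key (d + 1) A B S hB hS with h | ⟨i, hi, hc⟩
    · exact Or.inl h
    have h := ih (A.erase i) (B \ S i) (fun j => S j \ S i)
      (fun j hj => Finset.sdiff_subset_sdiff (hB j (Finset.mem_of_mem_erase hj)) subset_rfl) ?_
    · have h1 := Finset.card_sdiff_add_card_eq_card (hB i hi)
      have h2 := Finset.card_erase_add_one hi
      rcases h with h | h
      · left; omega
      · right; nlinarith
    · intro j hj D hD hDc hjD hsub
      have hiD : i ∉ D := fun h' => Finset.notMem_erase i A (hD h')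
      refine hS j (Finset.mem_of_mem_erase hj) (insert i D) ?_ ?_ ?_ ?_
      · exact Finset.insert_subset hi (hD.trans (Finset.erase_subset i A))
      · exact (Finset.card_insert_le i D).trans (by omega)
      · simp [hjD, Finset.ne_of_mem_erase hj]
      · intro e he
        by_cases hei : e ∈ S i
        · exact Finset.mem_biUnion.2 ⟨i, Finset.mem_insert_self i D, hei⟩
        · obtain ⟨l, hl, hel⟩ := Finset.mem_biUnion.1 (hsub (Finset.mem_sdiff.2 ⟨he, hei⟩))
          exact Finset.mem_biUnion.2
            ⟨l, Finset.mem_insert_of_mem hl, (Finset.mem_sdiff.1 hel).1⟩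

/-! ### Linear programming lifts of neighborly polytopes -/

/-- Let `p i = π (x i)` be points of a polyhedron `π (ℝᵏ₊ ∩ L)`. If the points `p a`, `a ∈ A`, lie
on a face of it that misses `p i`, then the support of `x i` is not contained in the union of the
supports of the `x a`: otherwise the segment from `x i` to the average of the `x a` could be
prolonged within `ℝᵏ₊ ∩ L`, and its image would leave the face through the wrong side. -/
theorem exists_mem_support_of_face {n k : ℕ} {ι : Type*}
    (π : (Fin k → ℝ) →ₗ[ℝ] EuclideanSpace ℝ (Fin n)) (L : AffineSubspace ℝ (Fin k → ℝ))
    (x : ι → Fin k → ℝ) (hx0 : ∀ i e, 0 ≤ x i e) (hxL : ∀ i, x i ∈ L)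
    (φ : EuclideanSpace ℝ (Fin n) →ₗ[ℝ] ℝ) (c : ℝ)
    (hφ : ∀ z, (∀ e, 0 ≤ z e) → z ∈ L → 0 ≤ φ (π z) + c)
    (A : Finset ι) (hA : A.Nonempty) (hzero : ∀ a ∈ A, φ (π (x a)) + c = 0)
    (i : ι) (hi : 0 < φ (π (x i)) + c) :
    ∃ e, x i e ≠ 0 ∧ ∀ a ∈ A, x a e = 0 := by
  by_contra hcon
  push Not at hcon
  have hcard : (0 : ℝ) < A.card := by exact_mod_cast hA.card_pos
  set w : ι → ℝ := fun _ => (A.card : ℝ)⁻¹ with hw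
  have hwsum : ∑ a ∈ A, w a = 1 := by simp [hw, hcard.ne']
  set y : Fin k → ℝ := ∑ a ∈ A, w a • x a with hy
  have hyL : y ∈ L := by
    have := affineCombination_mem_affineSpan (k := ℝ) hwsum x
    rw [Finset.affineCombination_eq_linear_combination A x w hwsum] at this
    exact (affineSpan_le.2 (Set.range_subset_iff.2 hxL)) this
  have hy0 : φ (π y) + c = 0 := by
    have : φ (π y) + c = ∑ a ∈ A, w a * (φ (π (x a)) + c) := by
      simp only [hy, map_sum, map_smul, smul_eq_mul, mul_add, Finset.sum_add_distrib]
      rw [← Finset.sum_mul, hwsum, one_mul]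
    rw [this]
    exact Finset.sum_eq_zero fun a ha => by rw [hzero a ha, mul_zero]
  have hypos : ∀ e, x i e ≠ 0 → 0 < y e := by
    intro e he
    obtain ⟨a, ha, hae⟩ := hcon e he
    simp only [hy, Finset.sum_apply, Pi.smul_apply, smul_eq_mul]
    refine Finset.sum_pos' (fun b _ => mul_nonneg (inv_nonneg.2 hcard.le) (hx0 b e)) ⟨a, ha, ?_⟩
    exact mul_pos (inv_pos.2 hcard) (lt_of_le_of_ne (hx0 a e) (Ne.symm hae))
  have hyn : ∀ e, 0 ≤ y e := by
    intro e
    simp only [hy, Finset.sum_apply, Pi.smul_apply, smul_eq_mul]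
    exact Finset.sum_nonneg fun b _ => mul_nonneg (inv_nonneg.2 hcard.le) (hx0 b e)
  have hev : ∀ᶠ ε : ℝ in nhdsWithin 0 (Set.Ioi 0), ∀ e, 0 ≤ y e + ε * (y e - x i e) := by
    refine eventually_all.2 fun e => ?_
    by_cases he : x i e = 0
    · filter_upwards [self_mem_nhdsWithin] with ε hε
      rw [he, sub_zero]
      exact add_nonneg (hyn e) (mul_nonneg (le_of_lt hε) (hyn e))
    · have hc : Continuous fun ε : ℝ => y e + ε * (y e - x i e) := by fun_prop
      have h0 := hc.tendsto 0
      simp only [zero_mul, add_zero] at h0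
      exact ((h0.mono_left nhdsWithin_le_nhds).eventually (lt_mem_nhds (hypos e he))).mono
        fun ε h => le_of_lt h
  obtain ⟨ε, hε, hεpos⟩ := (hev.and self_mem_nhdsWithin).exists
  have hεpos : 0 < ε := hεpos
  have hz : ε • (y - x i) + y ∈ L := by
    simpa using L.smul_vsub_vadd_mem ε hyL (hxL i) hyL
  have hz0 : ∀ e, 0 ≤ (ε • (y - x i) + y) e := by
    intro e
    have := hε e
    simp only [Pi.add_apply, Pi.smul_apply, Pi.sub_apply, smul_eq_mul]
    linarith
  have := hφ _ hz0 hz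
  simp only [map_add, map_smul, map_sub, smul_eq_mul] at this
  nlinarith

/-- An LP lift of the convex hull of `N ≥ 2` points is large as soon as every set of at most `d` of
the points is cut out by a supporting hyperplane. -/
theorem HasLPLift.card_bound_of_neighborly {n N d k : ℕ} (hN : 2 ≤ N) (hd : 1 ≤ d)
    (p : Fin N → EuclideanSpace ℝ (Fin n))
    (hp : ∀ A : Finset (Fin N), A.card ≤ d → ∃ (φ : EuclideanSpace ℝ (Fin n) →ₗ[ℝ] ℝ) (c : ℝ),
      (∀ i, 0 ≤ φ (p i) + c) ∧ ∀ i, φ (p i) + c = 0 ↔ i ∈ A)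
    (h : HasLPLift (convexHull ℝ (Set.range p)) k) :
    N ≤ k ∨ (d + 1) * (d + 2) ≤ 2 * k := by
  classical
  obtain ⟨π, L, hP⟩ := h
  have hmem : ∀ i, ∃ x : Fin k → ℝ, ((∀ e, 0 ≤ x e) ∧ x ∈ L) ∧ π x = p i := by
    intro i
    have : p i ∈ π '' {x | (∀ i, 0 ≤ x i) ∧ x ∈ L} := by
      rw [← hP]; exact subset_convexHull ℝ _ ⟨i, rfl⟩
    exact this
  choose x hx hxp using hmem
  have main : ∀ (i : Fin N) (A : Finset (Fin N)), A.Nonempty → A.card ≤ d → i ∉ A →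
      ∃ e, x i e ≠ 0 ∧ ∀ a ∈ A, x a e = 0 := by
    intro i A hA hAd hiA
    obtain ⟨φ, c, h0, h1⟩ := hp A hAd
    refine exists_mem_support_of_face π L x (fun i => (hx i).1) (fun i => (hx i).2) φ c ?_ A hA
      (fun a ha => by rw [hxp]; exact (h1 a).2 ha) i ?_
    · intro z hz hzL
      have hzP : π z ∈ convexHull ℝ (Set.range p) := by rw [hP]; exact ⟨z, ⟨hz, hzL⟩, rfl⟩
      have hsub : convexHull ℝ (Set.range p) ⊆ {q | -c ≤ φ q} :=
        convexHull_min (Set.range_subset_iff.2 fun i => by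
          have := h0 i; simp only [Set.mem_ofPred_eq]; linarith)
          (convex_halfSpace_ge φ.isLinear (-c))
      have := hsub hzP
      simp only [Set.mem_ofPred_eq] at this
      linarith
    · rw [hxp]
      exact lt_of_le_of_ne (h0 i) fun h => hiA ((h1 i).1 h.symm)
  have := coverFree_card_bound d (Finset.univ : Finset (Fin N)) (Finset.univ : Finset (Fin k))
    (fun i => Finset.univ.filter fun e => x i e ≠ 0) (fun i _ => Finset.subset_univ _) ?_
  · simpa using this
  · intro i _ D _ hDc hiD hsub
    -- The empty set does not determine a face in the sense needed here; enlarge it.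
    obtain ⟨D', hD', hD'c, hiD', hDD'⟩ : ∃ D' : Finset (Fin N), D'.Nonempty ∧ D'.card ≤ d ∧
        i ∉ D' ∧ D ⊆ D' := by
      rcases D.eq_empty_or_nonempty with rfl | hne
      · have : Nontrivial (Fin N) := Fin.nontrivial_iff_two_le.2 hN
        obtain ⟨j, hj⟩ := exists_ne i
        exact ⟨{j}, by simp, by simpa using hd, by simpa using hj.symm, by simp⟩
      · exact ⟨D, hne, hDc, hiD, subset_rfl⟩
    obtain ⟨e, he, hea⟩ := main i D' hD' hD'c hiD'
    have : e ∈ D.biUnion fun i => Finset.univ.filter fun e => x i e ≠ 0 :=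
      hsub (by simpa using he)
    obtain ⟨a, ha, hae⟩ := Finset.mem_biUnion.1 this
    exact (Finset.mem_filter.1 hae).2 (hea a (hDD' ha))

/-! ### Neighborliness of the trigonometric cyclic polytope -/

/-- The real trigonometric polynomials of degree at most `d`. Frequencies range over the integers
`-d, …, d`, so that product-to-sum formulas need no case distinction. -/
def trigPolynomials (d : ℕ) : Submodule ℝ (ℝ → ℝ) :=
  Submodule.span ℝ {f | ∃ k : ℤ, |k| ≤ d ∧
    (f = (fun θ => Real.cos (k * θ)) ∨ f = fun θ => Real.sin (k * θ))}

theorem cos_mem_trigPolynomials {d : ℕ} {k : ℤ} (hk : |k| ≤ d) :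
    (fun θ : ℝ => Real.cos (k * θ)) ∈ trigPolynomials d :=
  Submodule.subset_span ⟨k, hk, Or.inl rfl⟩

theorem sin_mem_trigPolynomials {d : ℕ} {k : ℤ} (hk : |k| ≤ d) :
    (fun θ : ℝ => Real.sin (k * θ)) ∈ trigPolynomials d :=
  Submodule.subset_span ⟨k, hk, Or.inr rfl⟩

theorem one_sub_cos_mul_mem_trigPolynomials {d : ℕ} (α : ℝ) {f : ℝ → ℝ}
    (hf : f ∈ trigPolynomials d) :
    (fun θ => (1 - Real.cos (θ - α)) * f θ) ∈ trigPolynomials (d + 1) := by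
  induction hf using Submodule.span_induction with
  | mem f hf =>
    obtain ⟨k, hk, hf⟩ := hf
    have h0 : |k| ≤ ((d + 1 : ℕ) : ℤ) := by push_cast; omega
    have h1 : |k + 1| ≤ ((d + 1 : ℕ) : ℤ) := by
      rw [abs_le] at hk ⊢; push_cast; omega
    have h2 : |k - 1| ≤ ((d + 1 : ℕ) : ℤ) := by
      rw [abs_le] at hk ⊢; push_cast; omega
    have c0 := cos_mem_trigPolynomials h0
    have c1 := cos_mem_trigPolynomials h1
    have c2 := cos_mem_trigPolynomials h2
    have s0 := sin_mem_trigPolynomials h0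
    have s1 := sin_mem_trigPolynomials h1
    have s2 := sin_mem_trigPolynomials h2
    rcases hf with rfl | rfl
    · have := Submodule.sub_mem _ (Submodule.sub_mem _ c0
        (Submodule.smul_mem _ (Real.cos α / 2) (Submodule.add_mem _ c1 c2)))
        (Submodule.smul_mem _ (Real.sin α / 2) (Submodule.sub_mem _ s1 s2))
      convert this using 1
      funext θ
      simp only [Pi.sub_apply, Pi.add_apply, Pi.smul_apply, smul_eq_mul]
      push_cast
      simp only [add_mul, sub_mul, one_mul, Real.cos_add, Real.cos_sub, Real.sin_add,
        Real.sin_sub]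
      ring
    · have := Submodule.sub_mem _ (Submodule.sub_mem _ s0
        (Submodule.smul_mem _ (Real.cos α / 2) (Submodule.add_mem _ s1 s2)))
        (Submodule.smul_mem _ (Real.sin α / 2) (Submodule.sub_mem _ c2 c1))
      convert this using 1
      funext θ
      simp only [Pi.sub_apply, Pi.add_apply, Pi.smul_apply, smul_eq_mul]
      push_cast
      simp only [add_mul, sub_mul, one_mul, Real.cos_add, Real.cos_sub, Real.sin_add,
        Real.sin_sub]
      ring
  | zero =>
    convert Submodule.zero_mem (trigPolynomials (d + 1)) using 1
    funext θ
    simp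
  | add f g _ _ hf hg =>
    convert Submodule.add_mem _ hf hg using 1
    funext θ
    simp only [Pi.add_apply]; ring
  | smul a f _ hf =>
    convert Submodule.smul_mem _ a hf using 1
    funext θ
    simp only [Pi.smul_apply, smul_eq_mul]; ring

theorem trigPolynomials_mono {d d' : ℕ} (h : d ≤ d') : trigPolynomials d ≤ trigPolynomials d' :=
  Submodule.span_mono fun _ ⟨k, hk, hf⟩ => ⟨k, hk.trans (by exact_mod_cast h), hf⟩

theorem prod_one_sub_cos_mem_trigPolynomials {ι : Type*} (A : Finset ι) (α : ι → ℝ) :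
    (fun θ => ∏ a ∈ A, (1 - Real.cos (θ - α a))) ∈ trigPolynomials A.card := by
  classical
  induction A using Finset.induction_on with
  | empty =>
    simpa using cos_mem_trigPolynomials (d := 0) (k := 0) (by simp)
  | insert a A ha ih =>
    rw [Finset.card_insert_of_notMem ha]
    simpa only [Finset.prod_insert ha] using one_sub_cos_mul_mem_trigPolynomials (α a) ih

theorem trigMomentCurve_cos {d m : ℕ} (hm : m < d) (θ : ℝ) :
    trigMomentCurve d θ ⟨2 * m, by omega⟩ = Real.cos (((m + 1 : ℕ) : ℝ) * θ) := by
  simp [trigMomentCurve]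

theorem trigMomentCurve_sin {d m : ℕ} (hm : m < d) (θ : ℝ) :
    trigMomentCurve d θ ⟨2 * m + 1, by omega⟩ = Real.sin (((m + 1 : ℕ) : ℝ) * θ) := by
  have h1 : (2 * m + 1) % 2 = 1 := by omega
  have h2 : (2 * m + 1) / 2 = m := by omega
  simp [trigMomentCurve, h1, h2]

/-- Trigonometric polynomials of degree at most `d` are the affine functions on the trigonometric
moment curve of degree `d`. -/
theorem exists_affine_of_mem_trigPolynomials {d : ℕ} {f : ℝ → ℝ} (hf : f ∈ trigPolynomials d) :
    ∃ (φ : EuclideanSpace ℝ (Fin (2 * d)) →ₗ[ℝ] ℝ) (c : ℝ),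
      ∀ θ, f θ = φ (trigMomentCurve d θ) + c := by
  induction hf using Submodule.span_induction with
  | mem f hf =>
    obtain ⟨k, hk, hf⟩ := hf
    rcases lt_trichotomy k 0 with h | rfl | h
    · obtain ⟨m, rfl⟩ : ∃ m : ℕ, k = -((m + 1 : ℕ) : ℤ) := ⟨(-k - 1).toNat, by omega⟩
      have hm : m < d := by rw [abs_neg, Nat.abs_cast] at hk; omega
      rcases hf with rfl | rfl
      · refine ⟨(EuclideanSpace.proj (𝕜 := ℝ) (⟨2 * m, by omega⟩ : Fin (2 * d))).toLinearMap, 0,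
          fun θ => ?_⟩
        simp only [ContinuousLinearMap.coe_coe, PiLp.proj_apply, add_zero]
        rw [trigMomentCurve_cos hm, ← Real.cos_neg]
        push_cast; ring_nf
      · refine ⟨-(EuclideanSpace.proj (𝕜 := ℝ) (⟨2 * m + 1, by omega⟩ :
          Fin (2 * d))).toLinearMap, 0, fun θ => ?_⟩
        simp only [LinearMap.neg_apply, ContinuousLinearMap.coe_coe, PiLp.proj_apply,
          add_zero]
        rw [trigMomentCurve_sin hm, ← Real.sin_neg]
        push_cast; ring_nf
    · rcases hf with rfl | rfl
      · exact ⟨0, 1, by simp⟩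
      · exact ⟨0, 0, by simp⟩
    · obtain ⟨m, rfl⟩ : ∃ m : ℕ, k = ((m + 1 : ℕ) : ℤ) := ⟨(k - 1).toNat, by omega⟩
      have hm : m < d := by rw [Nat.abs_cast] at hk; omega
      rcases hf with rfl | rfl
      · refine ⟨(EuclideanSpace.proj (𝕜 := ℝ) (⟨2 * m, by omega⟩ : Fin (2 * d))).toLinearMap, 0,
          fun θ => ?_⟩
        simp only [ContinuousLinearMap.coe_coe, PiLp.proj_apply, add_zero]
        rw [trigMomentCurve_cos hm]
        push_cast; ring_nf
      · refine ⟨(EuclideanSpace.proj (𝕜 := ℝ) (⟨2 * m + 1, by omega⟩ :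
          Fin (2 * d))).toLinearMap, 0, fun θ => ?_⟩
        simp only [ContinuousLinearMap.coe_coe, PiLp.proj_apply, add_zero]
        rw [trigMomentCurve_sin hm]
        push_cast; ring_nf
  | zero => exact ⟨0, 0, by simp⟩
  | add f g _ _ hf hg =>
    obtain ⟨φ, c, h⟩ := hf
    obtain ⟨ψ, e, h'⟩ := hg
    refine ⟨φ + ψ, c + e, fun θ => ?_⟩
    simp only [Pi.add_apply, LinearMap.add_apply, h, h']; ring
  | smul a f _ hf =>
    obtain ⟨φ, c, h⟩ := hf
    refine ⟨a • φ, a * c, fun θ => ?_⟩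
    simp only [Pi.smul_apply, LinearMap.smul_apply, smul_eq_mul, h]; ring

theorem one_sub_cos_eq_zero_iff {N : ℕ} (x a : Fin N) :
    1 - Real.cos (2 * Real.pi * ((x : ℕ) : ℝ) / N - 2 * Real.pi * ((a : ℕ) : ℝ) / N) = 0 ↔
      x = a := by
  have hN : 0 < N := x.pos
  have hN' : (0 : ℝ) < N := by exact_mod_cast hN
  constructor
  · intro h
    obtain ⟨n, hn⟩ := (Real.cos_eq_one_iff _).1 (sub_eq_zero.1 h).symm
    have h2 : (n : ℝ) * N = ((x : ℕ) : ℝ) - ((a : ℕ) : ℝ) := by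
      have hpi := Real.pi_pos
      field_simp at hn
      linarith
    have h3 : n * (N : ℤ) = ((x : ℕ) : ℤ) - ((a : ℕ) : ℤ) := by exact_mod_cast h2
    have hx := x.isLt
    have ha := a.isLt
    have hn1 : n < 1 := by
      by_contra hc
      have : (N : ℤ) ≤ n * N := by nlinarith
      omega
    have hn2 : -1 < n := by
      by_contra hc
      have : n * N ≤ -(N : ℤ) := by nlinarith
      omega
    have : n = 0 := by omega
    subst this
    exact Fin.ext (by omega)
  · rintro rfl
    simp

/-- The polytope `TC(N, 2d)` is `d`-neighborly: any `d` of its vertices are the zeros of the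
nonnegative trigonometric polynomial `∏ (1 - cos (θ - θₐ))` of degree `d`. -/
theorem trigCyclic_neighborly {N d : ℕ} (A : Finset (Fin N)) (hA : A.card ≤ d) :
    ∃ (φ : EuclideanSpace ℝ (Fin (2 * d)) →ₗ[ℝ] ℝ) (c : ℝ),
      (∀ i : Fin N, 0 ≤ φ (trigMomentCurve d (2 * Real.pi * ((i : ℕ) : ℝ) / (N : ℝ))) + c) ∧
      ∀ i : Fin N,
        φ (trigMomentCurve d (2 * Real.pi * ((i : ℕ) : ℝ) / (N : ℝ))) + c = 0 ↔ i ∈ A := by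
  obtain ⟨φ, c, h⟩ := exists_affine_of_mem_trigPolynomials (trigPolynomials_mono hA
    (prod_one_sub_cos_mem_trigPolynomials A fun a : Fin N => 2 * Real.pi * ((a : ℕ) : ℝ) / N))
  refine ⟨φ, c, fun i => ?_, fun i => ?_⟩
  · rw [← h]
    exact Finset.prod_nonneg fun a _ => sub_nonneg.2 (Real.cos_le_one _)
  · rw [← h]
    simp only [Finset.prod_eq_zero_iff, one_sub_cos_eq_zero_iff]
    simp

theorem sq_le_two_mul_xcLP_trigCyclicPolytope {d : ℕ} (hd : 2 ≤ d) :
    d ^ 2 ≤ 2 * xcLP (trigCyclicPolytope (d ^ 2) d) := by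
  have h := (trigCyclicPolytope_isPolytope (d ^ 2) d).hasLPLift_xcLP
  rcases HasLPLift.card_bound_of_neighborly (by nlinarith) (by omega) _
    (fun A hA => trigCyclic_neighborly A hA) h with h | h
  · exact h.trans (by omega)
  · refine le_trans ?_ h
    nlinarith

/-! ### Completing Gram matrices -/

section Gram

variable {V : Type*} [NormedAddCommGroup V] [InnerProductSpace ℂ V]

/-- Two families of vectors with the same Gram matrix on `S` can be made equal on `S` by moving one
of them by an isometry of the whole space. -/
theorem exists_gram_eq_and_eqOn [FiniteDimensional ℂ V] {ι : Type*} (v w : ι → V) (S : Set ι)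
    (h : ∀ i ∈ S, ∀ j ∈ S, inner ℂ (v i) (v j) = inner ℂ (w i) (w j)) :
    ∃ w' : ι → V, (∀ i j, inner ℂ (w' i) (w' j) = inner ℂ (w i) (w j)) ∧ ∀ i ∈ S, w' i = v i := by
  let f : (S →₀ ℂ) →ₗ[ℂ] V := Finsupp.linearCombination ℂ fun i : S => v i
  let g : (S →₀ ℂ) →ₗ[ℂ] V := Finsupp.linearCombination ℂ fun i : S => w i
  have hinner : ∀ x, inner ℂ (f x) (f x) = inner ℂ (g x) (g x) := by
    intro x
    simp only [f, g, Finsupp.linearCombination_apply, Finsupp.sum, sum_inner, inner_sum,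
      inner_smul_left, inner_smul_right]
    refine Finset.sum_congr rfl fun i _ => congrArg _ (Finset.sum_congr rfl fun j _ => ?_)
    rw [h j j.2 i i.2]
  have hnorm : ∀ x, ‖f x‖ = ‖g x‖ := fun x => by
    rw [@norm_eq_sqrt_re_inner ℂ, @norm_eq_sqrt_re_inner ℂ, hinner]
  obtain ⟨r, hr⟩ := LinearMap.exists_rightInverse_of_surjective g.rangeRestrict
    (LinearMap.range_eq_top.2 g.surjective_rangeRestrict)
  have hr' : ∀ u : LinearMap.range g, g (r u) = u := fun u =>
    congrArg Subtype.val (LinearMap.congr_fun hr u)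
  let U : LinearMap.range g →ₗᵢ[ℂ] V := ⟨f.comp r, fun u => by
    rw [LinearMap.comp_apply, hnorm, hr', Submodule.coe_norm]⟩
  refine ⟨fun i => U.extend (w i), fun i j => LinearIsometry.inner_map_map _ _ _, fun i hi => ?_⟩
  have hgw : g (Finsupp.single ⟨i, hi⟩ 1) = w i := by simp [g]
  have hfv : f (Finsupp.single ⟨i, hi⟩ 1) = v i := by simp [f]
  have hmem : w i ∈ LinearMap.range g := ⟨_, hgw⟩
  have h1 : U.extend (w i) = f (r ⟨w i, hmem⟩) := U.extend_apply ⟨w i, hmem⟩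
  have h2 : ‖f (r ⟨w i, hmem⟩ - Finsupp.single ⟨i, hi⟩ 1)‖ = 0 := by
    rw [hnorm, map_sub, hr', hgw, sub_self, norm_zero]
  rw [map_sub, norm_eq_zero, sub_eq_zero, hfv] at h2
  exact h1.trans h2

/-- A finite set of natural numbers in which every element other than `0` and `1` is the sum of two
positive elements. -/
def IsAdditionChain (C : Finset ℕ) : Prop :=
  ∀ m ∈ C, 2 ≤ m → ∃ a ∈ C, ∃ b ∈ C, 1 ≤ a ∧ 1 ≤ b ∧ a + b = m

/-- The double-and-add chain. -/
theorem exists_isAdditionChain (m : ℕ) (hm : 1 ≤ m) :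
    ∃ C : Finset ℕ, 0 ∈ C ∧ 1 ∈ C ∧ m ∈ C ∧ IsAdditionChain C ∧
      C.card ≤ 2 * Nat.log 2 m + 2 := by
  induction m using Nat.strong_induction_on with
  | _ m ih =>
    rcases Nat.lt_or_ge m 2 with h | h
    · obtain rfl : m = 1 := by omega
      refine ⟨{0, 1}, by simp, by simp, by simp, ?_, by simp⟩
      intro k hk hk2
      simp only [Finset.mem_insert, Finset.mem_singleton] at hk
      omega
    · obtain ⟨C, h0, h1, hC, hchain, hcard⟩ := ih (m / 2) (by omega) (by omega)
      refine ⟨insert m (insert (2 * (m / 2)) C), by simp [h0], by simp [h1], by simp, ?_, ?_⟩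
      · intro k hk hk2
        simp only [Finset.mem_insert] at hk
        by_cases hk' : k = 2 * (m / 2)
        · exact ⟨m / 2, by simp [hC], m / 2, by simp [hC], by omega, by omega, by omega⟩
        · rcases hk with rfl | hk | hk
          · exact ⟨2 * (k / 2), by simp, 1, by simp [h1], by omega, le_rfl, by omega⟩
          · exact absurd hk hk'
          · obtain ⟨a, ha, b, hb, hab⟩ := hchain k hk hk2
            exact ⟨a, by simp [ha], b, by simp [hb], hab⟩
      · have h2 : Nat.log 2 m = Nat.log 2 (m / 2) + 1 := Nat.log_of_one_lt_of_le (by omega) h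
        have h3 := Finset.card_insert_le m (insert (2 * (m / 2)) C)
        have h4 := Finset.card_insert_le (2 * (m / 2)) C
        omega

/-- Divide `ℕ` into blocks of length `d`. Suppose that the Toeplitz matrix `y (t - s)` is a Gram
matrix on the union of the blocks with number in an addition chain `C`. Then for every `m ∈ C` some
Gram matrix agrees with `y (t - s)` whenever the blocks of `s, t ≤ m` are equal or neighbors, or are
the two extreme blocks `0` and `m`. For `m = a + b` it is obtained by gluing the matrices for `a`
and for `b`, the latter shifted by `a` blocks, along two sides of the triangle of blocks
`0, a, a + b`, on which `y (t - s)` is a Gram matrix by assumption. -/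
theorem exists_gram_path [FiniteDimensional ℂ V] {N d : ℕ} (y : ZMod N → ℂ) {C : Finset ℕ}
    (h0 : 0 ∈ C) (hC : IsAdditionChain C) (u : ℕ → V)
    (hu : ∀ s t : ℕ, s / d ∈ C → t / d ∈ C → inner ℂ (u s) (u t) = y ((t : ZMod N) - s))
    (m : ℕ) (hm : m ∈ C) (hm1 : 1 ≤ m) :
    ∃ v : ℕ → V, ∀ s t : ℕ, s / d ≤ m → t / d ≤ m →
      (s / d ≤ t / d + 1 ∧ t / d ≤ s / d + 1 ∨
        (s / d = 0 ∨ s / d = m) ∧ (t / d = 0 ∨ t / d = m)) →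
      inner ℂ (v s) (v t) = y ((t : ZMod N) - s) := by
  induction m using Nat.strong_induction_on with
  | _ m ih =>
    rcases Nat.lt_or_ge m 2 with h | h
    · obtain rfl : m = 1 := by omega
      refine ⟨u, fun s t hs ht _ => hu s t ?_ ?_⟩
      · rcases Nat.le_one_iff_eq_zero_or_eq_one.1 hs with h | h <;> rw [h] <;> assumption
      · rcases Nat.le_one_iff_eq_zero_or_eq_one.1 ht with h | h <;> rw [h] <;> assumption
    · obtain ⟨a, ha, b, hb, ha1, hb1, rfl⟩ := hC m hm h
      obtain ⟨v₁, hv₁⟩ := ih a (by omega) ha ha1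
      obtain ⟨v₂, hv₂⟩ := ih b (by omega) hb hb1
      have hdiv : ∀ s, (s - d * a) / d = s / d - a := fun s => Nat.sub_mul_div s d a
      have hshift : ∀ s t : ℕ, a ≤ s / d → s / d ≤ a + b → a ≤ t / d → t / d ≤ a + b →
          (s / d ≤ t / d + 1 ∧ t / d ≤ s / d + 1 ∨
            (s / d = a ∨ s / d = a + b) ∧ (t / d = a ∨ t / d = a + b)) →
          inner ℂ (v₂ (s - d * a)) (v₂ (t - d * a)) = y ((t : ZMod N) - s) := by
        intro s t hs hs' ht ht' hst
        rw [hv₂ _ _ (by rw [hdiv]; omega) (by rw [hdiv]; omega) (by rw [hdiv, hdiv]; omega)]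
        have h1 : d * a ≤ s := (Nat.mul_le_mul_left d hs).trans (Nat.mul_div_le s d)
        have h2 : d * a ≤ t := (Nat.mul_le_mul_left d ht).trans (Nat.mul_div_le t d)
        rw [Nat.cast_sub h1, Nat.cast_sub h2, sub_sub_sub_cancel_right]
      obtain ⟨w, hw, hwv⟩ := exists_gram_eq_and_eqOn v₁ u {s | s / d = 0 ∨ s / d = a} (by
        intro s hs t ht
        change s / d = 0 ∨ s / d = a at hs
        change t / d = 0 ∨ t / d = a at ht
        rw [hv₁ s t (by omega) (by omega) (Or.inr ⟨hs, ht⟩), hu s t]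
        · rcases hs with h | h <;> rw [h] <;> assumption
        · rcases ht with h | h <;> rw [h] <;> assumption)
      have hwu : ∀ s t : ℕ, (s / d = 0 ∨ s / d = a ∨ s / d = a + b) →
          (t / d = 0 ∨ t / d = a ∨ t / d = a + b) →
          inner ℂ (w s) (w t) = y ((t : ZMod N) - s) := by
        intro s t hs ht
        rw [hw, hu s t]
        · rcases hs with h | h | h <;> rw [h] <;> assumption
        · rcases ht with h | h | h <;> rw [h] <;> assumption
      obtain ⟨w₂, hw₂, hw₂w⟩ := exists_gram_eq_and_eqOn w (fun s => v₂ (s - d * a))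
        {s | s / d = a ∨ s / d = a + b} (by
        intro s hs t ht
        change s / d = a ∨ s / d = a + b at hs
        change t / d = a ∨ t / d = a + b at ht
        rw [hwu s t (Or.inr hs) (Or.inr ht),
          hshift s t (by omega) (by omega) (by omega) (by omega) (Or.inr ⟨hs, ht⟩)])
      -- It remains to compare a block up to `a` with a block beyond `a`, in either order.
      have hmixed : ∀ s t : ℕ, s / d ≤ a → ¬ t / d ≤ a → t / d ≤ a + b →
          (t / d ≤ s / d + 1 ∨ s / d = 0 ∧ t / d = a + b) →
          v₁ s = w₂ s ∧ s / d = a ∨ v₁ s = w s ∧ w₂ t = w t ∧ s / d = 0 ∧ t / d = a + b := by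
        intro s t hs ht _ hst
        rcases hst with hst | ⟨hs0, htm⟩
        · have hsa : s / d = a := by omega
          exact Or.inl ⟨by rw [hw₂w s (Or.inl hsa), hwv s (Or.inr hsa)], hsa⟩
        · exact Or.inr ⟨(hwv s (Or.inl hs0)).symm, hw₂w t (Or.inr htm), hs0, htm⟩
      refine ⟨fun s => if s / d ≤ a then v₁ s else w₂ s, fun s t hs ht hst => ?_⟩
      by_cases hsa : s / d ≤ a <;> by_cases hta : t / d ≤ a <;> simp only [hsa, hta, if_true,
        if_false]
      · exact hv₁ s t hsa hta (by omega)
      · rcases hmixed s t hsa hta ht (by omega) with ⟨h1, h2⟩ | ⟨h1, h2, h3, h4⟩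
        · rw [h1, hw₂]
          exact hshift s t (by omega) hs (by omega) ht (by omega)
        · rw [h1, h2]
          exact hwu s t (Or.inl h3) (Or.inr (Or.inr h4))
      · rcases hmixed t s hta hsa hs (by omega) with ⟨h1, h2⟩ | ⟨h1, h2, h3, h4⟩
        · rw [h1, hw₂]
          exact hshift s t (by omega) hs (by omega) ht (by omega)
        · rw [h1, h2]
          exact hwu s t (Or.inr (Or.inr h4)) (Or.inl h3)
      · rw [hw₂]
        exact hshift s t (by omega) hs (by omega) ht (by omega)

/-! ### Fourier coefficients of a Gram matrix on a cyclic group -/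

/-- If the Gram matrix of `v` is constant, equal to `z`, along the `j`-th cyclic diagonal, then `z`
is the `j`-th moment of the nonnegative weights `‖∑ₖ χ(-xk) vₖ‖² / N²`. -/
theorem sum_norm_sq_mul_stdAddChar {N : ℕ} [NeZero N] (v : ZMod N → V) (j : ZMod N) (z : ℂ)
    (h : ∀ k, inner ℂ (v k) (v (k + j)) = z) :
    ∑ x : ZMod N,
      ((‖∑ k, ZMod.stdAddChar (-(x * k)) • v k‖ ^ 2 / (N : ℝ) ^ 2 : ℝ) : ℂ) *
        ZMod.stdAddChar (x * j) = z := by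
  have hN : (N : ℂ) ≠ 0 := NeZero.ne _
  have hstar : ∀ a : ZMod N, (starRingEnd ℂ) (ZMod.stdAddChar a) = ZMod.stdAddChar (-a) := by
    intro a
    rw [ZMod.stdAddChar_apply, ZMod.stdAddChar_apply, AddChar.map_neg_eq_inv,
      Circle.coe_inv_eq_conj]
  have hx : ∀ x : ZMod N,
      ((‖∑ k, ZMod.stdAddChar (-(x * k)) • v k‖ ^ 2 / (N : ℝ) ^ 2 : ℝ) : ℂ) *
        ZMod.stdAddChar (x * j) =
      (N : ℂ)⁻¹ ^ 2 * ∑ k, ∑ l, inner ℂ (v k) (v l) * ZMod.stdAddChar (x * (k + j - l)) := by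
    intro x
    have h1 : ((‖∑ k, ZMod.stdAddChar (-(x * k)) • v k‖ ^ 2 : ℝ) : ℂ) =
        ∑ k, ∑ l, inner ℂ (v k) (v l) * ZMod.stdAddChar (x * (k - l)) := by
      have := inner_self_eq_norm_sq_to_K (𝕜 := ℂ) (∑ k, ZMod.stdAddChar (-(x * k)) • v k)
      push_cast
      refine Eq.trans this.symm ?_
      simp only [sum_inner, inner_sum, inner_smul_left, inner_smul_right, hstar, neg_neg,
        Finset.mul_sum]
      rw [Finset.sum_comm]
      refine Finset.sum_congr rfl fun k _ => Finset.sum_congr rfl fun l _ => ?_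
      rw [show x * (k - l) = x * k + -(x * l) by ring, AddChar.map_add_eq_mul]
      ring
    rw [Complex.ofReal_div, h1]
    simp only [Finset.mul_sum, Finset.sum_mul, Finset.sum_div]
    refine Finset.sum_congr rfl fun k _ => Finset.sum_congr rfl fun l _ => ?_
    rw [show x * (k + j - l) = x * (k - l) + x * j by ring, AddChar.map_add_eq_mul]
    push_cast
    ring
  have hsum : ∀ k l : ZMod N, ∑ x : ZMod N, ZMod.stdAddChar (x * (k + j - l)) =
      if l = k + j then (N : ℂ) else 0 := by
    intro k l
    rw [AddChar.sum_mulShift _ (ZMod.isPrimitive_stdAddChar N), ZMod.card]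
    simp only [sub_eq_zero, eq_comm, Nat.cast_ite, Nat.cast_zero]
  rw [Finset.sum_congr rfl fun x _ => hx x, ← Finset.mul_sum, Finset.sum_comm]
  have hk : ∀ k : ZMod N, ∑ x : ZMod N, ∑ l, inner ℂ (v k) (v l) *
      ZMod.stdAddChar (x * (k + j - l)) = z * N := by
    intro k
    rw [Finset.sum_comm]
    simp only [← Finset.mul_sum, hsum, mul_ite, mul_zero, Finset.sum_ite_eq', Finset.mem_univ,
      if_true, h]
  rw [Finset.sum_congr rfl fun k _ => hk k, Finset.sum_const, Finset.card_univ, ZMod.card,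
    nsmul_eq_mul]
  field_simp

end Gram

/-! ### Semidefinite lifts of the trigonometric cyclic polytope -/

/-- The point of `ℝ²ᵈ` with coordinates `Re y₁, Im y₁, …, Re y_d, Im y_d`. -/
noncomputable def complexMoments (d : ℕ) (y : ℕ → ℂ) : EuclideanSpace ℝ (Fin (2 * d)) :=
  WithLp.toLp 2 fun j : Fin (2 * d) =>
    if (j : ℕ) % 2 = 0 then (y ((j : ℕ) / 2 + 1)).re else (y ((j : ℕ) / 2 + 1)).im

theorem complexMoments_congr {d : ℕ} {y z : ℕ → ℂ} (h : ∀ m, m ≤ d → y m = z m) :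
    complexMoments d y = complexMoments d z := by
  ext j
  have : (j : ℕ) / 2 + 1 ≤ d := by omega
  simp [complexMoments, h _ this]

theorem trigMomentCurve_eq_complexMoments {N : ℕ} [NeZero N] (d : ℕ) (x : ZMod N) :
    trigMomentCurve d (2 * Real.pi * ((x.val : ℕ) : ℝ) / (N : ℝ)) =
      complexMoments d fun m => ZMod.stdAddChar (x * (m : ZMod N)) := by
  have key : ∀ m : ℕ, ZMod.stdAddChar (x * (m : ZMod N)) =
      Complex.exp (((m : ℝ) * (2 * Real.pi * ((x.val : ℕ) : ℝ) / (N : ℝ)) : ℝ) * Complex.I) := by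
    intro m
    have : x * (m : ZMod N) = ((x.val * m : ℤ) : ZMod N) := by simp
    rw [this, ZMod.stdAddChar_coe]
    congr 1
    push_cast
    ring
  ext j
  simp only [trigMomentCurve, complexMoments, key, Complex.exp_ofReal_mul_I_re,
    Complex.exp_ofReal_mul_I_im]

theorem complexMoments_sum {ι : Type*} (s : Finset ι) (d : ℕ) (p : ι → ℝ) (y : ι → ℕ → ℂ) :
    complexMoments d (fun m => ∑ i ∈ s, (p i : ℂ) * y i m) =
      ∑ i ∈ s, p i • complexMoments d (y i) := by
  ext j
  simp only [complexMoments, WithLp.ofLp_sum, WithLp.ofLp_smul, Finset.sum_apply, Pi.smul_apply,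
    smul_eq_mul, Complex.re_sum, Complex.im_sum, Complex.re_ofReal_mul, Complex.im_ofReal_mul]
  split_ifs <;> rfl

theorem complexMoments_stdAddChar_mem_trigCyclicPolytope {N : ℕ} [NeZero N] (d : ℕ) (x : ZMod N) :
    (complexMoments d fun m => ZMod.stdAddChar (x * (m : ZMod N))) ∈ trigCyclicPolytope N d := by
  rw [← trigMomentCurve_eq_complexMoments]
  exact subset_convexHull ℝ _ ⟨⟨x.val, x.val_lt⟩, rfl⟩

/-- If `y` is, up to the lag `d`, constant on the cyclic diagonals of a Gram matrix of unit vectors,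
then its moments form a point of the polytope `TC(N, 2d)`. -/
theorem complexMoments_mem_trigCyclicPolytope {N : ℕ} [NeZero N] {V : Type*}
    [NormedAddCommGroup V] [InnerProductSpace ℂ V] (d : ℕ) (y : ℕ → ℂ)
    (hy0 : y 0 = 1) (v : ZMod N → V)
    (h : ∀ m : ℕ, m ≤ d → ∀ k : ZMod N, inner ℂ (v k) (v (k + m)) = y m) :
    complexMoments d y ∈ trigCyclicPolytope N d := by
  set p : ZMod N → ℝ := fun x =>
    ‖∑ k, ZMod.stdAddChar (-(x * k)) • v k‖ ^ 2 / (N : ℝ) ^ 2 with hp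
  have hmoment : ∀ m : ℕ, m ≤ d →
      ∑ x : ZMod N, (p x : ℂ) * ZMod.stdAddChar (x * (m : ZMod N)) = y m := fun m hm =>
    sum_norm_sq_mul_stdAddChar v m (y m) (h m hm)
  have hp1 : ∑ x, p x = 1 := by
    have := hmoment 0 (Nat.zero_le d)
    simp only [Nat.cast_zero, mul_zero, AddChar.map_zero_eq_one, mul_one, hy0] at this
    exact_mod_cast this
  rw [← complexMoments_congr hmoment, complexMoments_sum]
  exact (convex_convexHull ℝ _).sum_mem (fun x _ => by positivity) hp1
    fun x _ => complexMoments_stdAddChar_mem_trigCyclicPolytope d x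

open scoped ComplexOrder MatrixOrder in
/-- A PSD matrix `Bᴴ * B` is the Gram matrix of the columns of `B`. -/
theorem Matrix.PosSemidef.exists_gram {k : ℕ} {X : Matrix (Fin k) (Fin k) ℂ} (hX : X.PosSemidef) :
    ∃ u : Fin k → EuclideanSpace ℂ (Fin k), ∀ i j, inner ℂ (u i) (u j) = X i j := by
  obtain ⟨B, rfl⟩ := CStarAlgebra.nonneg_iff_eq_star_mul_self.1 hX.nonneg
  refine ⟨fun i => WithLp.toLp 2 fun r => B r i, fun i j => ?_⟩
  simp [EuclideanSpace.inner_eq_star_dotProduct, dotProduct, Matrix.mul_apply,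
    Matrix.star_eq_conjTranspose, mul_comm]

/-- The affine space of Hermitian matrices with unit diagonal whose `(s, t)` entry depends only on
the difference modulo `N` of the labels `e t` and `e s`. -/
def toeplitzSection (N : ℕ) {k : ℕ} (e : Fin k → ℕ) : AffineSubspace ℝ (HermitianMatrix k) where
  carrier := {X | ∃ y : ZMod N → ℂ, y 0 = 1 ∧
    ∀ s t, (X : Matrix (Fin k) (Fin k) ℂ) s t = y ((e t : ZMod N) - e s)}
  smul_vsub_vadd_mem' := by
    rintro c X Y Z ⟨x, hx0, hx⟩ ⟨y, hy0, hy⟩ ⟨z, hz0, hz⟩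
    refine ⟨fun a => c * (x a - y a) + z a, by simp [hx0, hy0, hz0], fun s t => ?_⟩
    simp [hx, hy, hz]

/-- The real-linear map reading off the moments `1, …, d` from the row `i` of a matrix, the `m`-th
moment from the column `g m`. -/
noncomputable def rowMoments (d : ℕ) {k : ℕ} (i : Fin k) (g : ℕ → Fin k) :
    HermitianMatrix k →ₗ[ℝ] EuclideanSpace ℝ (Fin (2 * d)) where
  toFun X := complexMoments d fun m => (X : Matrix (Fin k) (Fin k) ℂ) i (g m)
  map_add' X Y := by
    ext j
    simp only [complexMoments, PiLp.add_apply]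
    split_ifs <;> simp
  map_smul' c X := by
    ext j
    simp only [complexMoments, PiLp.smul_apply]
    split_ifs <;> simp

open scoped ComplexOrder in
/-- Let `C` be an addition chain containing `d - 1`. The PSD Toeplitz matrices on the union of the
blocks `[cd, cd + d)`, `c ∈ C`, form a lift of the polytope `TC(d², 2d)`. -/
theorem hasPSDLift_trigCyclicPolytope {d : ℕ} (hd : 2 ≤ d) {C : Finset ℕ} (h0 : 0 ∈ C)
    (h1 : 1 ∈ C) (hdC : d - 1 ∈ C) (hC : IsAdditionChain C) :
    ∃ k ≤ C.card * d, HasPSDLift (trigCyclicPolytope (d ^ 2) d) k := by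
  have : NeZero (d ^ 2) := ⟨by positivity⟩
  set N := d ^ 2 with hN
  set T : Finset ℕ := (C ×ˢ Finset.range d).image fun p => d * p.1 + p.2 with hT
  have hTmem : ∀ s, s / d ∈ C → s ∈ T := fun s hs =>
    Finset.mem_image.2 ⟨(s / d, s % d), Finset.mem_product.2
      ⟨hs, Finset.mem_range.2 (Nat.mod_lt s (by omega))⟩, Nat.div_add_mod s d⟩
  have hTcard : T.card ≤ C.card * d := by
    refine Finset.card_image_le.trans ?_
    rw [Finset.card_product, Finset.card_range]
  let e : Fin T.card → ℕ := fun i => T.equivFin.symm i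
  have h0T : 0 ∈ T := hTmem 0 (by simpa using h0)
  have hg : ∀ s, ∃ i, s ∈ T → e i = s := by
    intro s
    by_cases hs : s ∈ T
    · exact ⟨T.equivFin ⟨s, hs⟩, fun _ => by simp [e]⟩
    · exact ⟨T.equivFin ⟨0, h0T⟩, fun h => absurd h hs⟩
  choose g hg using hg
  have hsmall : ∀ m, m ≤ d → m ∈ T := by
    intro m hm
    refine hTmem m ?_
    rcases hm.eq_or_lt with rfl | hm
    · rwa [Nat.div_self (by omega)]
    · rwa [Nat.div_eq_of_lt hm]
  have hrow : ∀ (X : HermitianMatrix T.card) (y : ZMod N → ℂ),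
      (∀ s t, (X : Matrix (Fin T.card) (Fin T.card) ℂ) s t = y ((e t : ZMod N) - e s)) →
      rowMoments d (g 0) g X = complexMoments d fun m => y m := by
    intro X y hX
    refine complexMoments_congr
      (y := fun m => (X : Matrix (Fin T.card) (Fin T.card) ℂ) (g 0) (g m)) fun m hm => ?_
    simp only [hX]
    rw [hg m (hsmall m hm), hg 0 h0T, Nat.cast_zero, sub_zero]
  refine ⟨T.card, hTcard, rowMoments d (g 0) g, toeplitzSection N e, ?_⟩
  apply Set.Subset.antisymm
  · refine convexHull_min ?_ ?_
    · rintro _ ⟨x, rfl⟩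
      -- The vertex with number `x` lifts to a matrix of rank one.
      set χ : Fin T.card → ℂ := fun i => ZMod.stdAddChar (((x : ℕ) : ZMod N) * (e i : ZMod N))
        with hχ
      have hpsd := Matrix.posSemidef_vecMulVec_star_self χ
      have hentry : ∀ s t, Matrix.vecMulVec (star χ) χ s t =
          ZMod.stdAddChar (((x : ℕ) : ZMod N) * ((e t : ZMod N) - (e s : ZMod N))) := by
        intro s t
        simp only [Matrix.vecMulVec_apply, Pi.star_apply, hχ, RCLike.star_def]
        rw [mul_sub, AddChar.map_sub_eq_div, ZMod.stdAddChar_apply, ← Circle.coe_inv_eq_conj,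
          Circle.coe_inv, ← ZMod.stdAddChar_apply, div_eq_inv_mul]
      refine ⟨⟨Matrix.vecMulVec (star χ) χ, hpsd.1⟩, ⟨hpsd, ?_⟩, ?_⟩
      · exact ⟨fun a => ZMod.stdAddChar (((x : ℕ) : ZMod N) * a), by simp, hentry⟩
      · rw [hrow _ (fun a => ZMod.stdAddChar (((x : ℕ) : ZMod N) * a)) hentry,
          ← trigMomentCurve_eq_complexMoments, ZMod.val_natCast_of_lt x.isLt]
    · refine Convex.linear_image ?_ _
      intro X hX Y hY a b ha hb hab
      refine ⟨?_, (toeplitzSection N e).convex hX.2 hY.2 ha hb hab⟩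
      simpa using (hX.1.smul ha).add (hY.1.smul hb)
  · rintro _ ⟨X, ⟨hX, y, hy0, hy⟩, rfl⟩
    rw [hrow X y hy]
    obtain ⟨u, hu⟩ := hX.exists_gram
    obtain ⟨v, hv⟩ := exists_gram_path y h0 hC (d := d) (fun s => u (g s)) (by
      intro s t hs ht
      rw [hu, hy, hg s (hTmem s hs), hg t (hTmem t ht)]) (d - 1) hdC (by omega)
    refine complexMoments_mem_trigCyclicPolytope d (fun m => y m) (by simpa using hy0)
      (fun k => v k.val) fun m hm k => ?_
    have hdd : d * d = N := by rw [hN]; ring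
    have hblock : ∀ l : ZMod N, l.val / d ≤ d - 1 := by
      intro l
      have : l.val / d < d := Nat.div_lt_of_lt_mul (by rw [hdd]; exact l.val_lt)
      omega
    have hmN : m < N := by nlinarith
    have hk := k.val_lt
    rw [hv _ _ (hblock k) (hblock (k + m)), ZMod.natCast_zmod_val, ZMod.natCast_zmod_val,
      add_sub_cancel_left]
    have hmv : (m : ZMod N).val = m := ZMod.val_natCast_of_lt hmN
    rcases Nat.lt_or_ge (k.val + m) N with hlt | hge
    · -- No wrap-around: the two indices lie in the same or in adjacent blocks.
      left
      rw [ZMod.val_add_of_lt (by rwa [hmv]), hmv]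
      have h2 : (k.val + m) / d ≤ (k.val + d) / d := Nat.div_le_div_right (by omega)
      rw [Nat.add_div_right _ (by omega)] at h2
      have h3 : k.val / d ≤ (k.val + m) / d := Nat.div_le_div_right (by omega)
      omega
    · -- Wrap-around: the two indices lie in the last and in the first block.
      right
      have h2 : (k + (m : ZMod N)).val = k.val + m - N := by
        have := ZMod.val_add_val_of_le (a := k) (b := (m : ZMod N)) (by rwa [hmv])
        omega
      have h3 : (k + (m : ZMod N)).val / d = 0 := Nat.div_eq_of_lt (by omega)
      have h4 : d - 1 ≤ k.val / d := by
        rw [Nat.le_div_iff_mul_le (by omega), Nat.sub_mul, one_mul]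
        omega
      exact ⟨Or.inr (le_antisymm (hblock k) h4), Or.inl h3⟩

theorem xcPSD_trigCyclicPolytope_le {d : ℕ} (hd : 2 ≤ d) :
    xcPSD (trigCyclicPolytope (d ^ 2) d) ≤ (2 * Nat.log 2 d + 2) * d := by
  obtain ⟨C, h0, h1, hdC, hC, hcard⟩ := exists_isAdditionChain (d - 1) (by omega)
  obtain ⟨k, hk, hlift⟩ := hasPSDLift_trigCyclicPolytope hd h0 h1 hdC hC
  have hlog : Nat.log 2 (d - 1) ≤ Nat.log 2 d := Nat.log_mono_right (Nat.sub_le d 1)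
  exact (Nat.sInf_le hlift).trans (hk.trans (Nat.mul_le_mul_right d (by omega)))

/-! ### Asymptotics -/

/-- The condition `3 ≤ d` ensures `1 ≤ log d`, which absorbs the constant term; moreover
`2 / log 2 < 4`. -/
theorem natLog_two_bound {d : ℕ} (hd : 3 ≤ d) :
    ((2 * Nat.log 2 d + 2 : ℕ) : ℝ) ≤ 6 * Real.log d := by
  have hd' : (3 : ℝ) ≤ d := by exact_mod_cast hd
  have h1 : 1 ≤ Real.log d := by
    rw [Real.le_log_iff_exp_le (by linarith)]
    exact Real.exp_one_lt_three.le.trans hd'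
  have h2 : (Nat.log 2 d : ℝ) * Real.log 2 ≤ Real.log d := by
    rw [← Real.log_pow]
    refine Real.log_le_log (by positivity) ?_
    exact_mod_cast Nat.pow_log_le_self 2 (by omega)
  have h3 := Real.log_two_gt_d9
  have h4 : (0 : ℝ) ≤ Nat.log 2 d := Nat.cast_nonneg _
  push_cast
  nlinarith

theorem mainTheorem5 :
    ∃ P : (d : ℕ) → Set (EuclideanSpace ℝ (Fin (2 * d))),
      (∀ d, IsPolytope (P d)) ∧
      (∀ d, P d = trigCyclicPolytope (d ^ 2) d) ∧
      (fun d : ℕ => (xcPSD (P d) : ℝ)) =O[atTop] (fun d : ℕ => (d : ℝ) * Real.log (d : ℝ)) ∧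
      (fun d : ℕ => (d : ℝ) ^ 2) =O[atTop] (fun d : ℕ => (xcLP (P d) : ℝ)) ∧
      (fun d : ℕ => (xcPSD (P d) : ℝ) / (xcLP (P d) : ℝ)) =O[atTop]
        (fun d : ℕ => Real.log (d : ℝ) / (d : ℝ)) := by
  have hpsd : (fun d : ℕ => (xcPSD (trigCyclicPolytope (d ^ 2) d) : ℝ)) =O[atTop]
      (fun d : ℕ => (d : ℝ) * Real.log (d : ℝ)) := by
    refine IsBigO.of_bound 6 ((eventually_ge_atTop 3).mono fun d hd => ?_)
    have h1 : (xcPSD (trigCyclicPolytope (d ^ 2) d) : ℝ) ≤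
        ((2 * Nat.log 2 d + 2 : ℕ) : ℝ) * d := by
      exact_mod_cast xcPSD_trigCyclicPolytope_le (by omega)
    have h2 := mul_le_mul_of_nonneg_right (natLog_two_bound hd) (Nat.cast_nonneg (α := ℝ) d)
    rw [Real.norm_of_nonneg (Nat.cast_nonneg _), Real.norm_of_nonneg
      (mul_nonneg (Nat.cast_nonneg d) (Real.log_natCast_nonneg d))]
    linarith
  have hlp : (fun d : ℕ => (d : ℝ) ^ 2) =O[atTop]
      (fun d : ℕ => (xcLP (trigCyclicPolytope (d ^ 2) d) : ℝ)) := by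
    refine IsBigO.of_bound 2 ((eventually_ge_atTop 2).mono fun d hd => ?_)
    rw [Real.norm_of_nonneg (by positivity), Real.norm_of_nonneg (by positivity)]
    exact_mod_cast sq_le_two_mul_xcLP_trigCyclicPolytope hd
  refine ⟨fun d => trigCyclicPolytope (d ^ 2) d, fun d => trigCyclicPolytope_isPolytope _ _,
    fun d => rfl, hpsd, hlp, ?_⟩
  have hinv : (fun d : ℕ => (xcLP (trigCyclicPolytope (d ^ 2) d) : ℝ)⁻¹) =O[atTop]
      (fun d : ℕ => ((d : ℝ) ^ 2)⁻¹) :=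
    hlp.inv_rev ((eventually_ge_atTop 1).mono fun d hd h => by
      have : (0 : ℝ) < d := by exact_mod_cast hd
      exact absurd h (by positivity))
  refine ((hpsd.mul hinv).congr_left fun d => (div_eq_mul_inv _ _).symm).congr' .rfl ?_
  filter_upwards [eventually_ge_atTop 1] with d hd
  have : (d : ℝ) ≠ 0 := by positivity
  field_simp
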